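/- Let $(X,d)$ be a complete metric space which is \emph{Busemann concave}: any two points are joined by a geodesic, i.e. a map $\gamma:[0,1]\to X$ with $d(\gamma(s),\gamma(t))=|s-t|\,d(\gamma(0),\gamma(1))$, and for any two geodesics $\gamma,\eta$ with $\gamma(0)=\eta(0)$ the function $t\mapsto d(\gamma(t),\eta(t))$ is concave on $[0,1]$. Let $n\in[0,\infty)$ and let $\mathcal H^n$ be the $n$-dimensional Hausdorff measure of $X$, normalized by the factor $\omega_n2^{-n}$, $\omega_n=\pi^{n/2}/\Gamma(\frac n2+1)$ (so that it is Lebesgue measure on Euclidean $\mathbb R^n$ for integers $n$). Assume that $\mathcal H^n$ is non-trivial, i.e. $0<\mathcal H^n(B_r(x))<\infty$ for some $x\in X$ and $r>0$, where $B_r(x)$ denotes the open ball. Then $0<\mathcal H^n(B_r(x))<\infty$ for all $x\in X$ and $r>0$, and the following hold. \begin{enumerate} \item (Measure contraction property $MCP(0,n)$.) For every $x\in X$ and every Borel set $A\subset X$ with $0<\mathcal H^n(A)<\infty$ there is a Borel probability measure $\Pi$ on the space of geodesics of $X$ (with the topology of uniform convergence) such that, with $e_t(\gamma)=\gamma(t)$,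 one has $(e_0)_*\Pi=\delta_x$, $(e_1)_*\Pi=\mathcal H^n(A)^{-1}\mathcal H^n|_A$ and \[(e_t)_*\bigl(t^n\,\mathcal H^n(A)\,\Pi\bigr)\le\mathcal H^n\qquad\text{for all }t\in[0,1].\] \item (Bishop--Gromov comparison $BG(0,n)$.) For all $x\in X$ and $0<r<R$, \[\frac{\mathcal H^n(B_R(x))}{\mathcal H^n(B_r(x))}\le\frac{\omega_nR^n}{\omega_nr^n}=\frac{R^n}{r^n}.\] \item (Doubling.) $\mathcal H^n(B_{2r}(x))\le 2^n\,\mathcal H^n(B_r(x))$ for all $x\in X$ and $r>0$. \item (Weak $(1,1)$-Poincar\'e inequality.) For all $x\in X$, $r>0$, every $u:X\to\mathbb R$ that is integrable on $B_r(x)$, and every $1$-weak upper gradient $g:X\to[0,\infty]$ of $u$, \[\int_{B_r(x)}|u-u_{B_r(x)}|\,d\mathcal H^n\le 2^{n+1}\,r\int_{B_{3r}(x)}g\,d\mathcal H^n,\qquad u_{B_r(x)}=\frac1{\mathcal H^n(B_r(x))}\int_{B_r(x)}u\,d\mathcal H^n.\] Here a Borel function $g$ is a $1$-weak upper gradient of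 $u$ if $|u(\gamma(0))-u(\gamma(L))|\le\int_0^Lg(\gamma(s))\,ds$ for all rectifiable curves $\gamma:[0,L]\to X$, $L>0$, parametrized by arc length, outside a family $F$ of vanishing $1$-modulus: the infimum of $\int_X\rho\,d\mathcal H^n$ over Borel $\rho:X\to[0,\infty]$ with $\int_0^L\rho(\gamma(s))\,ds\ge1$ for all $\gamma\in F$ is $0$. \end{enumerate} -/

import Mathlib

open MeasureTheory Set
open scoped ENNReal unitInterval

noncomputable section

namespace BusemannConcave

/-- Constant speed (minimal) geodesics parametrized by `[0,1]`:
`d(γ(s), γ(t)) = |s - t| d(γ(0), γ(1))`. -/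
def Geod (X : Type*) [MetricSpace X] : Type _ :=
  {γ : C(I, X) // ∀ s t : I, dist (γ s) (γ t) = |(s : ℝ) - t| * dist (γ 0) (γ 1)}

/-- The topology of uniform convergence on the space of geodesics. -/
instance (X : Type*) [MetricSpace X] : TopologicalSpace (Geod X) :=
  inferInstanceAs (TopologicalSpace
    {γ : C(I, X) // ∀ s t : I, dist (γ s) (γ t) = |(s : ℝ) - t| * dist (γ 0) (γ 1)})

/-- The Borel σ-algebra on the space of geodesics. -/
instance (X : Type*) [MetricSpace X] : MeasurableSpace (Geod X) := borel (Geod X)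

instance (X : Type*) [MetricSpace X] : BorelSpace (Geod X) := ⟨rfl⟩

/-- The evaluation map `e_t(γ) = γ(t)`. -/
def ev {X : Type*} [MetricSpace X] (t : I) (γ : Geod X) : X := γ.1 t

/-- Any two points are joined by a geodesic. -/
def IsGeodesicSpace (X : Type*) [MetricSpace X] : Prop :=
  ∀ x y : X, ∃ γ : Geod X, ev 0 γ = x ∧ ev 1 γ = y

/-- A geodesic space is Busemann concave if `t ↦ d(γ(t), η(t))` is concave on `[0,1]` for all
geodesics `γ`, `η` with a common starting point. (`IccExtend` only serves to regard a function
on the unit interval as a function of a real variable.) -/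
def IsBusemannConcave (X : Type*) [MetricSpace X] : Prop :=
  IsGeodesicSpace X ∧
    ∀ γ η : Geod X, ev 0 γ = ev 0 η →
      ConcaveOn ℝ (Icc (0 : ℝ) 1)
        (IccExtend zero_le_one fun t : I => dist (ev t γ) (ev t η))

/-- The constant `ω_n = π^{n/2} / Γ(n/2 + 1)`, for integers `n` the volume of the unit ball
of `n`-dimensional Euclidean space. -/
def omega (n : ℝ) : ℝ := Real.pi ^ (n / 2) / Real.Gamma (n / 2 + 1)

/-- The volume `ω_n r^n` of a ball of radius `r` in the flat `n`-dimensional model space. -/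
def modelVolume (n r : ℝ) : ℝ := omega n * r ^ n

/-- The `n`-dimensional Hausdorff measure, with the normalization
`ω_n ∑ (diam U_i / 2)^n`, which for integers `n` gives Lebesgue measure on Euclidean `ℝⁿ`. -/
def hausdorff (X : Type*) [MetricSpace X] [MeasurableSpace X] [BorelSpace X] (n : ℝ) :
    Measure X :=
  ENNReal.ofReal (omega n / 2 ^ n) • Measure.hausdorffMeasure n

section MetricMeasure

variable {X : Type*} [MetricSpace X] [MeasurableSpace X]

/-- All balls of positive radius have positive and finite measure. -/
def BallsPosFinite (μ : Measure X) : Prop :=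
  ∀ (x : X) (r : ℝ), 0 < r → 0 < μ (Metric.ball x r) ∧ μ (Metric.ball x r) < ∞

/-- The measure contraction property `MCP(0,N)`: for every point `x` and every measurable `A` with
`0 < μ(A) < ∞` there is a probability measure `Π` on the space of geodesics whose evaluations
interpolate between `δ_x` and `μ|_A / μ(A)`, with `(e_t)_* (t^N μ(A) Π) ≤ μ` for `t ∈ [0,1]`.
(As one marginal is a Dirac mass, the coupling of the marginals induced by `Π` is the only one,
hence it is optimal.) -/
def MCPZero (μ : Measure X) (N : ℝ) : Prop :=
  BallsPosFinite μ ∧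
    ∀ (x : X) (A : Set X), MeasurableSet A → 0 < μ A → μ A < ∞ →
      ∃ P : Measure (Geod X), IsProbabilityMeasure P ∧
        P.map (ev 0) = Measure.dirac x ∧
        P.map (ev 1) = (μ A)⁻¹ • μ.restrict A ∧
        ∀ t : I, ((ENNReal.ofReal ((t : ℝ) ^ N) * μ A) • P).map (ev t) ≤ μ

/-- The Bishop–Gromov volume comparison `BG(0,N)`. -/
def BishopGromovZero (μ : Measure X) (N : ℝ) : Prop :=
  BallsPosFinite μ ∧
    ∀ (x : X) (r R : ℝ), 0 < r → r < R →
      μ (Metric.ball x R) / μ (Metric.ball x r) ≤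
        ENNReal.ofReal (modelVolume N R / modelVolume N r)

/-- `μ` is doubling with doubling constant `C`. -/
def IsDoublingWith (μ : Measure X) (C : ℝ≥0∞) : Prop :=
  BallsPosFinite μ ∧
    ∀ (x : X) (r : ℝ), 0 < r → μ (Metric.ball x (2 * r)) ≤ C * μ (Metric.ball x r)

end MetricMeasure

/-- Non-constant compact rectifiable curves, parametrized by arc length on `[0, length]`
(the values of `toFun` outside this interval play no role). -/
structure RectCurve (X : Type*) [MetricSpace X] where
  length : ℝ
  length_pos : 0 < length
  toFun : ℝ → X
  unitSpeed : HasUnitSpeedOn toFun (Icc 0 length)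

/-- The line integral `∫_γ g ds`. -/
def RectCurve.lineIntegral {X : Type*} [MetricSpace X] (γ : RectCurve X) (g : X → ℝ≥0∞) : ℝ≥0∞ :=
  ∫⁻ s in Icc 0 γ.length, g (γ.toFun s)

section UpperGradient

variable {X : Type*} [MetricSpace X] [MeasurableSpace X]

/-- The `1`-modulus of a family of rectifiable curves. -/
def modulusOne (μ : Measure X) (F : Set (RectCurve X)) : ℝ≥0∞ :=
  ⨅ (ρ : X → ℝ≥0∞) (_ : Measurable ρ) (_ : ∀ γ ∈ F, 1 ≤ γ.lineIntegral ρ), ∫⁻ x, ρ x ∂μ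

/-- A Borel function `g : X → [0,∞]` is a `1`-weak upper gradient of `u : X → ℝ` if
`|u(γ(0)) - u(γ(L))| ≤ ∫_γ g ds` for all rectifiable curves `γ` outside a family of vanishing
`1`-modulus. Upper gradients are the special case in which that family is empty. -/
def IsWeakUpperGradient (μ : Measure X) (u : X → ℝ) (g : X → ℝ≥0∞) : Prop :=
  Measurable g ∧
    modulusOne μ {γ : RectCurve X |
      ¬ ENNReal.ofReal |u (γ.toFun 0) - u (γ.toFun γ.length)| ≤ γ.lineIntegral g} = 0

/-- The weak `(1,1)`-Poincaré inequality
`∫_{B_r(x)} |u - u_{B_r(x)}| dμ ≤ C r ∫_{B_{lam r}(x)} g dμ`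
for all balls, all functions `u` integrable on the ball `B_r(x)` and all
`1`-weak upper gradients `g` of `u`. -/
def WeakPoincareOneOne (μ : Measure X) (C : ℝ≥0∞) (lam : ℝ) : Prop :=
  ∀ (x : X) (r : ℝ), 0 < r → ∀ (u : X → ℝ) (g : X → ℝ≥0∞),
    IntegrableOn u (Metric.ball x r) μ → IsWeakUpperGradient μ u g →
      ∫⁻ y in Metric.ball x r, ENNReal.ofReal |u y - ⨍ z in Metric.ball x r, u z ∂μ| ∂μ ≤
        C * ENNReal.ofReal r * ∫⁻ y in Metric.ball x (lam * r), g y ∂μ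

end UpperGradient

end BusemannConcave

end

/-!
Concavity says that moving all points `y` to time `t` along geodesics from a fixed `x` shrinks
distances at most by the factor `t`, and therefore shrinks `𝓗ⁿ` at most by the factor `t ^ n`.
Applied to balls around `x` this is the Bishop–Gromov inequality, which yields doubling and
properness. Letting `t → 1`, it shows that almost every `y` lies in the interior of a geodesic
from `x`. Concavity also forbids branching, so the geodesic from `x` to such a `y` is unique and
depends continuously on `y`; the measure contraction property follows by pushing `𝓗ⁿ` forward to
the space of geodesics.

For the Poincaré inequality, `|u y - u z|` is bounded by the integral of an upper gradient along the
geodesic from `y` to `z`. Each half of this geodesic is the far half when seen from the opposite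
endpoint, where the contraction factor is at least `1/2`, and integrating over `y` and `z` costs at
most `2 ^ n` for each half. A weak upper gradient `g` becomes an upper gradient upon adding
`ε • ρ`, where `ρ` is integrable and has infinite integral along all exceptional curves.
-/

namespace BusemannConcave

open Filter Metric Topology

section Interpolation

variable {X : Type*} [MetricSpace X]

/-- `w` is an intermediate point of `x` and `y` that divides their distance in the ratio
`t : 1 - t`. -/
def DividesAt (t : ℝ) (x w y : X) : Prop :=
  dist x w = t * dist x y ∧ dist w y = (1 - t) * dist x y

theorem DividesAt.symm {t : ℝ} {x w y : X} (h : DividesAt t x w y) : DividesAt (1 - t) y w x := by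
  rw [DividesAt, sub_sub_cancel, dist_comm y w, dist_comm w x, dist_comm y x]
  exact ⟨h.2, h.1⟩

theorem dividesAt_zero_iff {x w y : X} : DividesAt 0 x w y ↔ w = x := by
  simp only [DividesAt, zero_mul, dist_eq_zero, sub_zero, one_mul]
  exact ⟨fun h => h.1.symm, by rintro rfl; exact ⟨rfl, rfl⟩⟩

theorem dividesAt_one_iff {x w y : X} : DividesAt 1 x w y ↔ w = y := by
  rw [← dividesAt_zero_iff (x := y) (y := x)]
  exact ⟨fun h => by simpa using h.symm, fun h => by simpa using h.symm⟩

theorem DividesAt.dividesAt_of_dividesAt {s t : ℝ} {x w y z : X} (hw : DividesAt s x w y)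
    (hy : DividesAt t x y z) (hst : s * t < 1) :
    DividesAt ((1 - t) / (1 - s * t)) z y w := by
  have hpos : 0 < 1 - s * t := sub_pos.2 hst
  obtain ⟨hxw, hwy⟩ := hw
  obtain ⟨hxy, hyz⟩ := hy
  have hwz : dist z w = (1 - s * t) * dist x z := by
    rw [dist_comm]
    have := dist_triangle w y z
    have := dist_triangle x w z
    rw [hxy] at hxw hwy
    apply le_antisymm <;> linarith
  rw [DividesAt, hwz, dist_comm z y, hyz, dist_comm y w, hwy, hxy]
  have hne : 1 - s * t ≠ 0 := hpos.ne'
  constructor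
  · rw [← mul_assoc, div_mul_cancel₀ _ hne]
  · rw [one_sub_div hne, ← mul_assoc (_ / _), div_mul_cancel₀ _ hne]
    ring

theorem isClosed_setOf_dividesAt {P : Type*} [TopologicalSpace P] {t : P → ℝ} {x w y : P → X}
    (ht : Continuous t) (hx : Continuous x) (hw : Continuous w) (hy : Continuous y) :
    IsClosed {p | DividesAt (t p) (x p) (w p) (y p)} :=
  (isClosed_eq (hx.dist hw) (ht.mul (hx.dist hy))).inter
    (isClosed_eq (hw.dist hy) ((continuous_const.sub ht).mul (hx.dist hy)))

variable (X) in
/-- In a geodesic space this says that geodesics do not branch: a geodesic from `x` that passes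
through `m` at an interior time is determined beyond `m`. Stating it for intermediate points
instead of geodesics avoids concatenations. -/
def IsNonbranching : Prop :=
  ∀ t ∈ Ioo (0 : ℝ) 1, ∀ x m y y' : X, DividesAt t x m y → DividesAt t x m y' → y = y'

variable (X) in
/-- The pairs `(x, y)` such that geodesics from `x` to `y` extend beyond `y`. A pair `(x, x)` is
extendable, with `x` itself as the extension. -/
def extendable : Set (X × X) :=
  {p | ∃ t ∈ Ioo (0 : ℝ) 1, ∃ z, DividesAt t p.1 p.2 z}

/-- Extended beyond `y`, the broken lines through `w` and through `w'` are geodesics which, run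
backwards, share their initial part up to `y`. -/
theorem IsNonbranching.eq_of_dividesAt (hX : IsNonbranching X) {x y w w' : X}
    (hxy : (x, y) ∈ extendable X) {s : ℝ} (hs : s ∈ Icc (0 : ℝ) 1)
    (hw : DividesAt s x w y) (hw' : DividesAt s x w' y) : w = w' := by
  obtain ⟨t, ⟨ht0, ht1⟩, z, hz⟩ := hxy
  rcases hs.2.eq_or_lt with rfl | hs1
  · rw [dividesAt_one_iff.1 hw, dividesAt_one_iff.1 hw']
  have hst : s * t < t := mul_lt_of_lt_one_left ht0 hs1
  have hst1 : s * t < 1 := hst.trans ht1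
  have hratio : (1 - t) / (1 - s * t) ∈ Ioo (0 : ℝ) 1 :=
    ⟨div_pos (by linarith) (by linarith), (div_lt_one (by linarith)).2 (by linarith)⟩
  exact hX _ hratio z y w w' (hw.dividesAt_of_dividesAt hz hst1)
    (hw'.dividesAt_of_dividesAt hz hst1)

end Interpolation

section Geodesics

variable {X : Type*} [MetricSpace X]

theorem continuous_ev (t : I) : Continuous (ev t : Geod X → X) :=
  (continuous_eval_const (F := C(I, X)) t).comp continuous_subtype_val

/-- The position of a geodesic at a real time, constant outside `[0,1]`. -/
noncomputable def Geod.point (γ : Geod X) (t : ℝ) : X := ev (projIcc 0 1 zero_le_one t) γ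

theorem Geod.point_coe (γ : Geod X) (t : I) : γ.point t = ev t γ := by
  simp only [point, projIcc_val]

theorem Geod.point_zero (γ : Geod X) : γ.point 0 = ev 0 γ := γ.point_coe 0

theorem Geod.point_one (γ : Geod X) : γ.point 1 = ev 1 γ := γ.point_coe 1

theorem Geod.dist_point (γ : Geod X) {s t : ℝ} (hs : s ∈ Icc (0 : ℝ) 1)
    (ht : t ∈ Icc (0 : ℝ) 1) :
    dist (γ.point s) (γ.point t) = |s - t| * dist (ev 0 γ) (ev 1 γ) := by
  lift s to I using hs
  lift t to I using ht
  simp only [point_coe]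
  exact γ.2 s t

theorem Geod.dividesAt_point (γ : Geod X) {t : ℝ} (ht : t ∈ Icc (0 : ℝ) 1) :
    DividesAt t (ev 0 γ) (γ.point t) (ev 1 γ) := by
  rw [DividesAt, ← point_zero, ← point_one, γ.dist_point (by simp) ht, γ.dist_point ht (by simp),
    point_zero, point_one, zero_sub, abs_neg, abs_of_nonneg ht.1, abs_sub_comm,
    abs_of_nonneg (sub_nonneg.2 ht.2)]
  exact ⟨rfl, rfl⟩

/-- By the triangle inequality, the distance of the endpoints cannot be attained unless all the
Lipschitz bounds are equalities. -/
theorem exists_geod_eq_of_dist_le (f : ℝ → X)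
    (h : ∀ s t, 0 ≤ s → s ≤ t → t ≤ 1 → dist (f s) (f t) ≤ (t - s) * dist (f 0) (f 1)) :
    ∃ γ : Geod X, ∀ t : I, ev t γ = f t := by
  have dist_of_le : ∀ s t : I, s ≤ t → dist (f s) (f t) = |(s : ℝ) - t| * dist (f 0) (f 1) := by
    intro s t hst
    have hst' : (s : ℝ) ≤ t := hst
    rw [abs_sub_comm, abs_of_nonneg (sub_nonneg.2 hst')]
    have h₁ := h 0 s le_rfl s.2.1 s.2.2
    have h₂ := h s t s.2.1 hst t.2.2
    have h₃ := h t 1 t.2.1 t.2.2 le_rfl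
    have := dist_triangle4 (f 0) (f s) (f t) (f 1)
    linarith
  have dist_eq (s t : I) : dist (f s) (f t) = |(s : ℝ) - t| * dist (f 0) (f 1) := by
    rcases le_total s t with hst | hst
    · exact dist_of_le s t hst
    · rw [dist_comm, abs_sub_comm, dist_of_le t s hst]
  have hcont : Continuous fun t : I => f t :=
    (LipschitzWith.of_dist_le_mul (K := (dist (f 0) (f 1)).toNNReal) fun s t => by
      rw [dist_eq, Real.coe_toNNReal _ dist_nonneg, mul_comm, Subtype.dist_eq,
        Real.dist_eq]).continuous
  exact ⟨⟨⟨fun t => f t, hcont⟩, by simpa using dist_eq⟩, fun t => rfl⟩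

theorem dist_le_of_dist_le_of_dist_le {f : ℝ → X} {t C : ℝ}
    (hl : ∀ a b, 0 ≤ a → a ≤ b → b ≤ t → dist (f a) (f b) ≤ (b - a) * C)
    (hr : ∀ a b, t ≤ a → a ≤ b → b ≤ 1 → dist (f a) (f b) ≤ (b - a) * C)
    {a b : ℝ} (ha : 0 ≤ a) (hab : a ≤ b) (hb : b ≤ 1) : dist (f a) (f b) ≤ (b - a) * C := by
  rcases le_total b t with hbt | htb
  · exact hl a b ha hab hbt
  rcases le_total t a with hta | hat
  · exact hr a b hta hab hb
  calc dist (f a) (f b) ≤ dist (f a) (f t) + dist (f t) (f b) := dist_triangle _ _ _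
    _ ≤ (t - a) * C + (b - t) * C := add_le_add (hl a t ha hat le_rfl) (hr t b le_rfl htb hb)
    _ = (b - a) * C := by ring

theorem Geod.dist_point_comp_le (γ : Geod X) {a b c ℓ C : ℝ} (hℓ : 0 < ℓ) (hca : c ≤ a)
    (hab : a ≤ b) (hb : b ≤ c + ℓ) (hC : dist (ev 0 γ) (ev 1 γ) = ℓ * C) :
    dist (γ.point ((a - c) / ℓ)) (γ.point ((b - c) / ℓ)) ≤ (b - a) * C := by
  have mem {τ : ℝ} (h₀ : c ≤ τ) (h₁ : τ ≤ c + ℓ) : (τ - c) / ℓ ∈ Icc (0 : ℝ) 1 :=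
    ⟨div_nonneg (by linarith) hℓ.le, (div_le_one hℓ).2 (by linarith)⟩
  rw [γ.dist_point (mem hca (by linarith)) (mem (by linarith) hb), hC, ← sub_div,
    sub_sub_sub_cancel_right, abs_div, abs_of_pos hℓ, abs_sub_comm,
    abs_of_nonneg (sub_nonneg.2 hab)]
  apply le_of_eq
  field_simp

theorem IsGeodesicSpace.exists_geod_point_eq (hX : IsGeodesicSpace X) {t : ℝ}
    (ht : t ∈ Ioo (0 : ℝ) 1) {x w y : X} (hw : DividesAt t x w y) :
    ∃ γ : Geod X, ev 0 γ = x ∧ ev 1 γ = y ∧ γ.point t = w := by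
  obtain ⟨ht0, ht1⟩ := ht
  have ht1' : 0 < 1 - t := sub_pos.2 ht1
  obtain ⟨γ, rfl, hγw⟩ := hX x w
  obtain ⟨η, rfl, rfl⟩ := hX w y
  let f : ℝ → X := fun τ => if τ ≤ t then γ.point ((τ - 0) / t) else η.point ((τ - t) / (1 - t))
  have f_of_le {τ : ℝ} (hτ : τ ≤ t) : f τ = γ.point ((τ - 0) / t) := if_pos hτ
  have f_t : f t = ev 0 η := by
    rw [f_of_le le_rfl, sub_zero, div_self ht0.ne', γ.point_one, hγw]
  have f_of_ge {τ : ℝ} (hτ : t ≤ τ) : f τ = η.point ((τ - t) / (1 - t)) := by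
    rcases hτ.eq_or_lt with rfl | hlt
    · rw [f_t, sub_self, zero_div, η.point_zero]
    · exact if_neg hlt.not_ge
  have f_zero : f 0 = ev 0 γ := by
    rw [f_of_le ht0.le, sub_self, zero_div, γ.point_zero]
  have f_one : f 1 = ev 1 η := by
    rw [f_of_ge ht1.le, div_self ht1'.ne', η.point_one]
  obtain ⟨θ, hθ⟩ := exists_geod_eq_of_dist_le f fun a b ha hab hb => by
    rw [f_zero, f_one]
    refine dist_le_of_dist_le_of_dist_le (t := t) (fun a b ha hab hb => ?_)
      (fun a b ha hab hb => ?_) ha hab hb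
    · rw [f_of_le (hab.trans hb), f_of_le hb]
      exact γ.dist_point_comp_le ht0 ha hab (by linarith) (by rw [hγw]; exact hw.1)
    · rw [f_of_ge ha, f_of_ge (ha.trans hab)]
      exact η.dist_point_comp_le ht1' ha hab (by linarith) hw.2
  refine ⟨θ, by simpa [f_zero] using hθ 0, by simpa [f_one] using hθ 1, ?_⟩
  rw [← f_t, ← hθ ⟨t, ht0.le, ht1.le⟩, ← θ.point_coe]

end Geodesics

section Concavity

variable {X : Type*} [MetricSpace X]

theorem IsBusemannConcave.mul_dist_le (hX : IsBusemannConcave X) {t : ℝ}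
    (ht : t ∈ Ioc (0 : ℝ) 1) {x y y' w w' : X} (hw : DividesAt t x w y)
    (hw' : DividesAt t x w' y') : t * dist y y' ≤ dist w w' := by
  rcases ht.2.eq_or_lt with rfl | ht1
  · rw [dividesAt_one_iff.1 hw, dividesAt_one_iff.1 hw', one_mul]
  obtain ⟨γ, rfl, rfl, rfl⟩ := hX.1.exists_geod_point_eq ⟨ht.1, ht1⟩ hw
  obtain ⟨η, h0, rfl, rfl⟩ := hX.1.exists_geod_point_eq ⟨ht.1, ht1⟩ hw'
  have hconc : ConcaveOn ℝ (Icc (0 : ℝ) 1) fun t => dist (γ.point t) (η.point t) :=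
    hX.2 γ η h0.symm
  have := hconc.2 (show (0 : ℝ) ∈ _ by simp) (show (1 : ℝ) ∈ _ by simp)
    (sub_nonneg.2 ht.2) ht.1.le (by ring)
  simpa [Geod.point_zero, Geod.point_one, h0] using this

theorem IsBusemannConcave.isNonbranching (hX : IsBusemannConcave X) : IsNonbranching X := by
  intro t ht x m y y' hy hy'
  have h : t * dist y y' ≤ t * 0 := by
    simpa using hX.mul_dist_le (Ioo_subset_Ioc_self ht) hy hy'
  exact dist_le_zero.1 (le_of_mul_le_mul_left h ht.1)

end Concavity

section Selection

variable {X : Type*} [MetricSpace X]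

/-- A choice of a geodesic for every pair of endpoints. -/
noncomputable def IsGeodesicSpace.geod (h : IsGeodesicSpace X) (x y : X) : Geod X :=
  (h x y).choose

theorem IsGeodesicSpace.ev_zero_geod (h : IsGeodesicSpace X) (x y : X) : ev 0 (h.geod x y) = x :=
  (h x y).choose_spec.1

theorem IsGeodesicSpace.ev_one_geod (h : IsGeodesicSpace X) (x y : X) : ev 1 (h.geod x y) = y :=
  (h x y).choose_spec.2

/-- The point at time `t` on the chosen geodesic from `x` to `y`. -/
noncomputable def IsGeodesicSpace.interp (h : IsGeodesicSpace X) (x y : X) (t : ℝ) : X :=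
  (h.geod x y).point t

theorem IsGeodesicSpace.dividesAt_interp (h : IsGeodesicSpace X) (x y : X) {t : ℝ}
    (ht : t ∈ Icc (0 : ℝ) 1) : DividesAt t x (h.interp x y t) y := by
  simpa only [interp, ev_zero_geod, ev_one_geod] using (h.geod x y).dividesAt_point ht

theorem IsGeodesicSpace.dist_interp_le (h : IsGeodesicSpace X) (x y : X) {t : ℝ}
    (ht : t ∈ Icc (0 : ℝ) 1) : dist x (h.interp x y t) ≤ dist x y := by
  rw [(h.dividesAt_interp x y ht).1]
  exact mul_le_of_le_one_left dist_nonneg ht.2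

theorem measurableSet_of_isSigmaCompact {Y : Type*} [TopologicalSpace Y] [T2Space Y]
    [MeasurableSpace Y] [OpensMeasurableSpace Y] {s : Set Y} (hs : IsSigmaCompact s) :
    MeasurableSet s := by
  obtain ⟨K, hK, rfl⟩ := hs
  exact .iUnion fun n => (hK n).measurableSet

variable [ProperSpace X]

theorem measurableSet_extendable [MeasurableSpace X] [BorelSpace X] :
    MeasurableSet (extendable X) := by
  have : LocallyCompactSpace (Ioo (0 : ℝ) 1) := isOpen_Ioo.locallyCompactSpace
  let C : Set ((X × X) × (Ioo (0 : ℝ) 1 × X)) := {q | DividesAt q.2.1 q.1.1 q.1.2 q.2.2}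
  have hC : IsClosed C :=
    isClosed_setOf_dividesAt (by fun_prop) (by fun_prop) (by fun_prop) (by fun_prop)
  have himage : extendable X = Prod.fst '' C := by
    ext p
    constructor
    · rintro ⟨t, ht, z, hz⟩
      exact ⟨(p, ⟨t, ht⟩, z), hz, rfl⟩
    · rintro ⟨⟨p, t, z⟩, hz, rfl⟩
      exact ⟨t, t.2, z, hz⟩
  rw [himage]
  exact measurableSet_of_isSigmaCompact
    ((isSigmaCompact_univ.of_isClosed_subset hC (subset_univ C)).image continuous_fst)

/-- Intermediate points of extendable pairs are unique, and being an intermediate point is a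
closed condition, so all limits of `interp` along converging arguments agree. -/
theorem IsGeodesicSpace.continuousOn_interp (h : IsGeodesicSpace X) (hbr : IsNonbranching X) :
    ContinuousOn (fun q : (X × X) × ℝ => h.interp q.1.1 q.1.2 q.2)
      (extendable X ×ˢ Icc (0 : ℝ) 1) := by
  rintro ⟨⟨x, y⟩, t⟩ ⟨hxy, ht⟩
  let F : (X × X) × ℝ → X := fun q => h.interp q.1.1 q.1.2 q.2
  let S : Set ((X × X) × ℝ) := extendable X ×ˢ Icc (0 : ℝ) 1
  have hbounded : ∀ᶠ q in 𝓝[S] ((x, y), t), F q ∈ closedBall x (dist x y + 1) := by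
    have hcont : Continuous fun q : (X × X) × ℝ => dist x q.1.1 + dist q.1.1 q.1.2 := by fun_prop
    have hnear := hcont.tendsto ((x, y), t) |>.eventually_lt_const
      (show _ < dist x y + 1 by simp)
    filter_upwards [nhdsWithin_le_nhds hnear, self_mem_nhdsWithin] with q hq hqS
    rw [mem_closedBall']
    have := dist_triangle x q.1.1 (F q)
    have := h.dist_interp_le q.1.1 q.1.2 hqS.2
    linarith
  refine (isCompact_closedBall x _).tendsto_nhds_of_unique_mapClusterPt hbounded
    fun w _ hw => ?_
  obtain ⟨U, hU, hUw⟩ := mapClusterPt_iff_ultrafilter.1 hw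
  have hclosed : IsClosed {p : ((X × X) × ℝ) × X | DividesAt p.1.2 p.1.1.1 p.2 p.1.1.2} :=
    isClosed_setOf_dividesAt (by fun_prop) (by fun_prop) (by fun_prop) (by fun_prop)
  have hlim : Tendsto (fun q => (q, F q)) U (𝓝 (((x, y), t), w)) :=
    (tendsto_id'.2 (hU.trans nhdsWithin_le_nhds)).prodMk_nhds hUw
  have hdiv : DividesAt t x w y := hclosed.mem_of_tendsto hlim <| by
    filter_upwards [hU self_mem_nhdsWithin] with q hq using h.dividesAt_interp _ _ hq.2
  exact hbr.eq_of_dividesAt hxy ht hdiv (h.dividesAt_interp x y ht)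

theorem IsGeodesicSpace.continuousOn_geod (h : IsGeodesicSpace X) (hbr : IsNonbranching X)
    (x : X) : ContinuousOn (h.geod x) {y | (x, y) ∈ extendable X} := by
  rw [continuousOn_iff_continuous_domRestrict]
  have hcont : Continuous fun q : {y // (x, y) ∈ extendable X} × I => ev q.2 (h.geod x q.1) := by
    have := (h.continuousOn_interp hbr).comp_continuous
      (f := fun q : {y // (x, y) ∈ extendable X} × I => ((x, (q.1 : X)), (q.2 : ℝ)))
      (by fun_prop) fun q => ⟨q.1.2, q.2.2⟩
    simpa only [interp, Geod.point_coe, Function.comp_def] using this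
  exact continuous_induced_rng.2 (ContinuousMap.curry ⟨_, hcont⟩).continuous

theorem IsGeodesicSpace.aemeasurable_interp [MeasurableSpace X] [BorelSpace X]
    (h : IsGeodesicSpace X) (hbr : IsNonbranching X) {Ω : Type*} [MeasurableSpace Ω]
    {ν : Measure Ω} {c : Ω → (X × X) × ℝ} (hc : Measurable c)
    (hν : ∀ᵐ ω ∂ν, c ω ∈ extendable X ×ˢ Icc (0 : ℝ) 1) :
    AEMeasurable (fun ω => h.interp (c ω).1.1 (c ω).1.2 (c ω).2) ν := by
  classical
  let S : Set ((X × X) × ℝ) := extendable X ×ˢ Icc (0 : ℝ) 1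
  have hS : MeasurableSet S := measurableSet_extendable.prod measurableSet_Icc
  let F : (X × X) × ℝ → X := fun q => h.interp q.1.1 q.1.2 q.2
  refine ⟨S.piecewise F (fun q => q.1.1) ∘ c,
    ((h.continuousOn_interp hbr).measurable_piecewise (by fun_prop) hS).comp hc, ?_⟩
  filter_upwards [hν] with ω hω
  exact (piecewise_eq_of_mem S F _ hω).symm

end Selection

section Contraction

variable {X : Type*} [MetricSpace X] [MeasurableSpace X] {μ : Measure X} {n : ℝ}

/-- The `t`-contractions towards a point `x` compress `μ` at most by the factor `t ^ n`. This is
the measure contraction property `MCP(0,n)` in terms of contraction maps instead of measures on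
the space of geodesics. -/
def HasContractionBound (μ : Measure X) (n : ℝ) : Prop :=
  ∀ (x : X), ∀ t ∈ Ioc (0 : ℝ) 1, ∀ Φ : X → X, (∀ y, DividesAt t x (Φ y) y) →
    ∀ B : Set X, μ (Φ ⁻¹' B) ≤ ENNReal.ofReal (t⁻¹ ^ n) * μ B

theorem IsBusemannConcave.hasContractionBound_hausdorff [BorelSpace X]
    (hX : IsBusemannConcave X) (hn : 0 ≤ n) : HasContractionBound (hausdorff X n) n := by
  intro x t ht Φ hΦ B
  have hanti : AntilipschitzWith (Real.toNNReal t⁻¹) Φ := by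
    refine AntilipschitzWith.of_le_mul_dist fun y z => ?_
    rw [Real.coe_toNNReal _ (inv_nonneg.2 ht.1.le), le_inv_mul_iff₀ ht.1]
    exact hX.mul_dist_le ht (hΦ y) (hΦ z)
  rw [hausdorff, Measure.smul_apply, Measure.smul_apply, smul_eq_mul, smul_eq_mul, mul_left_comm,
    ← ENNReal.ofReal_rpow_of_pos (inv_pos.2 ht.1)]
  gcongr
  exact hanti.hausdorffMeasure_preimage_le hn B

theorem HasContractionBound.measure_ball_le (hμ : HasContractionBound μ n)
    (h : IsGeodesicSpace X) (x : X) {r R : ℝ} (hr : 0 < r) (hrR : r ≤ R) :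
    μ (ball x R) ≤ ENNReal.ofReal ((R / r) ^ n) * μ (ball x r) := by
  have hR : 0 < R := hr.trans_le hrR
  have ht : r / R ∈ Ioc (0 : ℝ) 1 := ⟨div_pos hr hR, (div_le_one hR).2 hrR⟩
  have hcontr : ∀ y, DividesAt (r / R) x (h.interp x y (r / R)) y := fun y =>
    h.dividesAt_interp x y (Ioc_subset_Icc_self ht)
  have hsub : ball x R ⊆ (fun y => h.interp x y (r / R)) ⁻¹' ball x r := fun y hy => by
    rw [mem_preimage, mem_ball', (hcontr y).1, div_mul_comm]
    exact mul_lt_of_lt_one_left hr ((div_lt_one hR).2 (mem_ball'.1 hy))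
  rw [← inv_div r R]
  exact (measure_mono hsub).trans (hμ x _ ht _ hcontr _)

theorem HasContractionBound.ballsPosFinite (hμ : HasContractionBound μ n)
    (h : IsGeodesicSpace X)
    (hnontriv : ∃ (x : X) (r : ℝ), 0 < r ∧ 0 < μ (ball x r) ∧ μ (ball x r) < ∞) :
    BallsPosFinite μ := by
  obtain ⟨x₀, r, hr, hpos, hfin⟩ := hnontriv
  have finite_center (R : ℝ) : μ (ball x₀ R) < ∞ :=
    calc μ (ball x₀ R) ≤ μ (ball x₀ (max r R)) :=
          measure_mono (ball_subset_ball (le_max_right r R))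
      _ ≤ _ * μ (ball x₀ r) := hμ.measure_ball_le h x₀ hr (le_max_left r R)
      _ < ∞ := ENNReal.mul_lt_top ENNReal.ofReal_lt_top hfin
  intro x s hs
  refine ⟨pos_iff_ne_zero.2 fun hzero => hpos.ne' (measure_mono_null
    (ball_subset_ball' (by linarith) : ball x₀ r ⊆ ball x (s + (r + dist x₀ x))) ?_),
    (measure_mono (ball_subset_ball' le_rfl)).trans_lt (finite_center (s + dist x x₀))⟩
  refine nonpos_iff_eq_zero.1 ((hμ.measure_ball_le h x hs ?_).trans_eq (by rw [hzero, mul_zero]))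
  have : 0 ≤ dist x₀ x := dist_nonneg
  linarith

theorem HasContractionBound.exponent_nonneg (hμ : HasContractionBound μ n)
    (h : IsGeodesicSpace X) (hb : BallsPosFinite μ) (x : X) : 0 ≤ n := by
  have hle : 1 * μ (ball x 1) ≤ ENNReal.ofReal ((2 / 1) ^ n) * μ (ball x 1) := by
    rw [one_mul]
    exact (measure_mono (ball_subset_ball one_le_two)).trans
      (hμ.measure_ball_le h x one_pos one_le_two)
  have hone : (1 : ℝ) ≤ 2 ^ n := by
    rwa [ENNReal.mul_le_mul_iff_left (hb x 1 one_pos).1.ne' (hb x 1 one_pos).2.ne,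
      ENNReal.one_le_ofReal, div_one] at hle
  by_contra! hn
  exact hone.not_gt (Real.rpow_lt_one_of_one_lt_of_neg one_lt_two hn)

theorem HasContractionBound.bishopGromovZero (hμ : HasContractionBound μ n)
    (h : IsGeodesicSpace X) (hb : BallsPosFinite μ) : BishopGromovZero μ n := by
  refine ⟨hb, fun x r R hr hrR => ENNReal.div_le_of_le_mul ?_⟩
  have hn : 0 ≤ n := hμ.exponent_nonneg h hb x
  have homega : omega n ≠ 0 :=
    (div_pos (Real.rpow_pos_of_pos Real.pi_pos _) (Real.Gamma_pos_of_pos (by positivity))).ne'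
  rw [modelVolume, modelVolume, mul_div_mul_left _ _ homega,
    ← Real.div_rpow (hr.trans hrR).le hr.le]
  exact hμ.measure_ball_le h x hr hrR.le

theorem HasContractionBound.isDoublingWith (hμ : HasContractionBound μ n)
    (h : IsGeodesicSpace X) (hb : BallsPosFinite μ) : IsDoublingWith μ ((2 : ℝ≥0∞) ^ n) := by
  refine ⟨hb, fun x r hr => ?_⟩
  have := hμ.measure_ball_le h x hr (le_mul_of_one_le_left hr.le one_le_two)
  rwa [mul_div_cancel_right₀ _ hr.ne', ← ENNReal.ofReal_rpow_of_pos two_pos,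
    ENNReal.ofReal_ofNat] at this

theorem totallyBounded_of_le_measure_ball [OpensMeasurableSpace X] {s : Set X}
    (hfin : ∀ ε : ℝ, 0 < ε → μ (thickening ε s) ≠ ∞)
    (hball : ∀ ε : ℝ, 0 < ε → ∃ m ≠ 0, ∀ y ∈ s, m ≤ μ (ball y ε)) : TotallyBounded s := by
  rw [Metric.totallyBounded_iff]
  by_contra! hcover
  obtain ⟨ε, hε, hcover⟩ := hcover
  have : Std.Symm fun a b : X => ε ≤ dist a b := ⟨fun a b hab => by rwa [dist_comm]⟩
  obtain ⟨f, hfs, hsep⟩ := exists_seq_of_forall_finset_exists' (· ∈ s)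
    (fun a b => ε ≤ dist a b) fun F _ => by
      obtain ⟨y, hys, hy⟩ := not_subset.1 (hcover F F.finite_toSet)
      exact ⟨y, hys, fun z hz => by simpa [dist_comm] using mt (mem_biUnion hz) hy⟩
  obtain ⟨m, hm, hmf⟩ := hball (ε / 2) (half_pos hε)
  have hdisj : Pairwise (Function.onFun Disjoint fun i => ball (f i) (ε / 2)) := fun i j hij =>
    ball_disjoint_ball (by simpa only [add_halves] using hsep hij)
  have hunion : μ (⋃ i, ball (f i) (ε / 2)) ≠ ∞ :=
    ne_top_of_le_ne_top (hfin _ (half_pos hε)) <| measure_mono <| iUnion_subset fun i =>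
      ball_subset_thickening (hfs i) _
  have hfinite := Measure.finite_const_le_meas_of_disjoint_iUnion μ (pos_iff_ne_zero.2 hm)
    (fun i => isOpen_ball.measurableSet) hdisj hunion
  simp only [hmf _ (hfs _)] at hfinite
  exact infinite_univ hfinite

theorem HasContractionBound.properSpace [BorelSpace X] [CompleteSpace X]
    (hμ : HasContractionBound μ n) (h : IsGeodesicSpace X) (hb : BallsPosFinite μ) :
    ProperSpace X := by
  refine ProperSpace.of_isCompact_closedBall_of_le 0 fun x R hR => ?_
  refine TotallyBounded.isCompact_of_isClosed
    (totallyBounded_of_le_measure_ball (μ := μ) (fun ε hε => ?_) fun ε hε => ?_)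
    isClosed_closedBall
  · refine ne_top_of_le_ne_top (hb x (R + ε) (by positivity)).2.ne (measure_mono fun y hy => ?_)
    obtain ⟨z, hz, hyz⟩ := mem_thickening_iff.1 hy
    have := dist_triangle y z x
    rw [mem_ball]
    linarith [mem_closedBall.1 hz]
  · refine ⟨(ENNReal.ofReal (((ε + R) / ε) ^ n))⁻¹ * μ (ball x ε),
      mul_ne_zero (ENNReal.inv_ne_zero.2 ENNReal.ofReal_ne_top) (hb x ε hε).1.ne',
      fun y hy => ?_⟩
    have hpos : 0 < ((ε + R) / ε) ^ n := by positivity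
    rw [ENNReal.inv_mul_le_iff (by simpa using hpos) ENNReal.ofReal_ne_top]
    have hsub : ball x ε ⊆ ball y (ε + R) :=
      ball_subset_ball' (by linarith [mem_closedBall'.1 hy])
    exact (measure_mono hsub).trans (hμ.measure_ball_le h y hε (by linarith))

theorem HasContractionBound.measure_ball_le_measure_inter_extendable
    (hμ : HasContractionBound μ n) (h : IsGeodesicSpace X) (x : X) (R : ℝ) :
    μ (ball x R) ≤ μ (ball x R ∩ {y | (x, y) ∈ extendable X}) := by
  let E : Set X := {y | (x, y) ∈ extendable X}
  have hle : ∀ t ∈ Ioo (0 : ℝ) 1,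
      μ (ball x R) ≤ ENNReal.ofReal (t⁻¹ ^ n) * μ (ball x R ∩ E) := fun t ht => by
    have hcontr : ∀ y, DividesAt t x (h.interp x y t) y := fun y =>
      h.dividesAt_interp x y (Ioo_subset_Icc_self ht)
    have hsub : ball x R ⊆ (fun y => h.interp x y t) ⁻¹' (ball x R ∩ E) := fun y hy =>
      ⟨mem_ball'.2 ((h.dist_interp_le x y (Ioo_subset_Icc_self ht)).trans_lt (mem_ball'.1 hy)),
        t, ht, y, hcontr y⟩
    exact (measure_mono hsub).trans (hμ x t (Ioo_subset_Ioc_self ht) _ hcontr _)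
  have hlim : Tendsto (fun t : ℝ => ENNReal.ofReal (t⁻¹ ^ n)) (𝓝[<] 1) (𝓝 1) := by
    have hcont : ContinuousAt (fun t : ℝ => ENNReal.ofReal (t⁻¹ ^ n)) 1 :=
      ENNReal.continuous_ofReal.continuousAt.comp
        ((continuousAt_inv₀ one_ne_zero).rpow_const (by simp))
    simpa using hcont.tendsto.mono_left nhdsWithin_le_nhds
  refine ge_of_tendsto (by simpa using ENNReal.Tendsto.mul_const hlim (.inl one_ne_zero)) ?_
  filter_upwards [Ioo_mem_nhdsLT (zero_lt_one' ℝ)] with t ht using hle t ht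

theorem HasContractionBound.ae_extendable [BorelSpace X] [ProperSpace X]
    (hμ : HasContractionBound μ n) (h : IsGeodesicSpace X) (hb : BallsPosFinite μ) (x : X) :
    ∀ᵐ y ∂μ, (x, y) ∈ extendable X := by
  have hE : MeasurableSet {y | (x, y) ∈ extendable X} :=
    measurableSet_extendable.preimage measurable_prodMk_left
  have hball : ∀ k : ℕ, ∀ᵐ y ∂μ, y ∈ ball x (k + 1) → (x, y) ∈ extendable X := fun k => by
    have := (ae_eq_of_subset_of_measure_ge inter_subset_left
      (hμ.measure_ball_le_measure_inter_extendable h x (k + 1))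
      (isOpen_ball.measurableSet.inter hE).nullMeasurableSet
      (hb x (k + 1) (by positivity)).2.ne).mem_iff
    filter_upwards [this] with y hy hyB using (hy.2 hyB).2
  filter_upwards [ae_all_iff.2 hball] with y hy
  obtain ⟨k, hk⟩ := mem_iUnion.1 ((iUnion_ball_nat_succ x).ge (mem_univ y))
  exact hy k hk

theorem HasContractionBound.subsingleton_of_zero [BorelSpace X] (hμ : HasContractionBound μ 0)
    (h : IsGeodesicSpace X) (hb : BallsPosFinite μ) : Subsingleton X := by
  refine ⟨fun x y => ?_⟩
  by_contra hne
  obtain ⟨r, hr, hdist⟩ : ∃ r, 0 < r ∧ dist x y = 2 * r :=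
    ⟨dist x y / 2, half_pos (dist_pos.2 hne), by ring⟩
  have hdisj : Disjoint (ball x r) (ball y r) := ball_disjoint_ball (by linarith)
  have hle : μ (ball x r) + μ (ball y r) ≤ μ (ball x r) + 0 :=
    calc μ (ball x r) + μ (ball y r) = μ (ball x r ∪ ball y r) :=
          (measure_union hdisj isOpen_ball.measurableSet).symm
      _ ≤ μ (ball x (3 * r)) := measure_mono (union_subset (ball_subset_ball (by linarith))
          (ball_subset_ball' (by rw [dist_comm]; linarith)))
      _ ≤ μ (ball x r) + 0 := by
          simpa using hμ.measure_ball_le h x hr (le_mul_of_one_le_left hr.le (by norm_num))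
  exact (hb y r hr).1.not_ge ((ENNReal.add_le_add_iff_left (hb x r hr).2.ne).1 hle)

theorem HasContractionBound.rpow_mul_measure_preimage_le [BorelSpace X]
    (hμ : HasContractionBound μ n) (h : IsGeodesicSpace X) (hb : BallsPosFinite μ) {x : X}
    {t : ℝ} (ht : t ∈ Icc (0 : ℝ) 1) {Φ : X → X} (hΦ : ∀ y, DividesAt t x (Φ y) y)
    (B : Set X) : ENNReal.ofReal (t ^ n) * μ (Φ ⁻¹' B) ≤ μ B := by
  rcases ht.1.eq_or_lt with rfl | ht0
  · rcases (hμ.exponent_nonneg h hb x).eq_or_lt with rfl | hn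
    · have := hμ.subsingleton_of_zero h hb
      simp [Subsingleton.elim Φ id]
    · simp [Real.zero_rpow hn.ne']
  · have hpos : 0 < t ^ n := Real.rpow_pos_of_pos ht0 n
    have hle := hμ x t ⟨ht0, ht.2⟩ Φ hΦ B
    rwa [Real.inv_rpow ht.1, ENNReal.ofReal_inv_of_pos hpos, ← ENNReal.div_eq_inv_mul,
      ENNReal.le_div_iff_mul_le (.inl (by simpa using hpos)) (.inl ENNReal.ofReal_ne_top),
      mul_comm] at hle

end Contraction

section MeasureContraction

variable {X : Type*} [MetricSpace X] [ProperSpace X] [MeasurableSpace X] [BorelSpace X]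
  {μ : Measure X} {n : ℝ}

theorem HasContractionBound.aemeasurable_geod (hμ : HasContractionBound μ n)
    (h : IsGeodesicSpace X) (hbr : IsNonbranching X) (hb : BallsPosFinite μ) (x : X) :
    AEMeasurable (h.geod x) μ := by
  have hE : MeasurableSet {y | (x, y) ∈ extendable X} :=
    measurableSet_extendable.preimage measurable_prodMk_left
  have := (h.continuousOn_geod hbr x).aemeasurable (μ := μ) hE
  rwa [Measure.restrict_eq_self_of_ae_mem (s := {y | (x, y) ∈ extendable X})
    (hμ.ae_extendable h hb x)] at this

theorem HasContractionBound.rpow_smul_map_le (hμ : HasContractionBound μ n)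
    (h : IsGeodesicSpace X) (hbr : IsNonbranching X) (hb : BallsPosFinite μ) (x : X) (t : I) :
    ENNReal.ofReal ((t : ℝ) ^ n) • μ.map (ev t ∘ h.geod x) ≤ μ := by
  refine Measure.le_iff.2 fun B hB => ?_
  rw [Measure.smul_apply, smul_eq_mul, Measure.map_apply_of_aemeasurable
    ((continuous_ev t).measurable.comp_aemeasurable (hμ.aemeasurable_geod h hbr hb x)) hB]
  refine hμ.rpow_mul_measure_preimage_le h hb t.2 (x := x) (fun y => ?_) B
  rw [Function.comp_apply, ← Geod.point_coe]
  exact h.dividesAt_interp x y t.2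

/-- The required measure on geodesics is the image of the normalized restriction of `μ` to `A`
under `y ↦ h.geod x y`. -/
theorem HasContractionBound.mcpZero (hμ : HasContractionBound μ n) (h : IsGeodesicSpace X)
    (hbr : IsNonbranching X) (hb : BallsPosFinite μ) : MCPZero μ n := by
  refine ⟨hb, fun x A _ hA0 hAfin => ?_⟩
  let ν : Measure X := (μ A)⁻¹ • μ.restrict A
  have hν : IsProbabilityMeasure ν :=
    ProbabilityTheory.cond_isProbabilityMeasure_of_finite hA0.ne' hAfin.ne
  have hscale : μ A • ν = μ.restrict A := by
    rw [smul_smul, ENNReal.mul_inv_cancel hA0.ne' hAfin.ne, one_smul]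
  have hgeod : AEMeasurable (h.geod x) μ := hμ.aemeasurable_geod h hbr hb x
  have hgeodν : AEMeasurable (h.geod x) ν :=
    hgeod.mono_ac (ProbabilityTheory.cond_absolutelyContinuous (s := A))
  have hmap (t : I) : (ν.map (h.geod x)).map (ev t) = ν.map (ev t ∘ h.geod x) :=
    AEMeasurable.map_map_of_aemeasurable (continuous_ev t).measurable.aemeasurable hgeodν
  refine ⟨ν.map (h.geod x), Measure.isProbabilityMeasure_map hgeodν, ?_, ?_, fun t => ?_⟩
  · simp only [hmap, Function.comp_def, h.ev_zero_geod, Measure.map_const, measure_univ, one_smul]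
  · simp only [hmap, Function.comp_def, h.ev_one_geod, Measure.map_id']
    rfl
  · calc ((ENNReal.ofReal ((t : ℝ) ^ n) * μ A) • ν.map (h.geod x)).map (ev t)
        = ENNReal.ofReal ((t : ℝ) ^ n) • (μ.restrict A).map (ev t ∘ h.geod x) := by
          rw [Measure.map_smul, hmap, mul_smul, ← Measure.map_smul, hscale]
      _ ≤ ENNReal.ofReal ((t : ℝ) ^ n) • μ.map (ev t ∘ h.geod x) := by
          gcongr _ • ?_
          exact Measure.map_mono_of_aemeasurable Measure.restrict_le_self
            ((continuous_ev t).measurable.comp_aemeasurable hgeod)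
      _ ≤ μ := hμ.rpow_smul_map_le h hbr hb x t

end MeasureContraction

section UpperGradients

variable {X : Type*} [MetricSpace X] {u : X → ℝ} {g : X → ℝ≥0∞}

/-- `g` is an upper gradient of `u` if the upper gradient inequality holds along every rectifiable
curve. Measurability of `g` is not part of the notion. -/
def IsUpperGradient (u : X → ℝ) (g : X → ℝ≥0∞) : Prop :=
  ∀ γ : RectCurve X,
    ENNReal.ofReal |u (γ.toFun 0) - u (γ.toFun γ.length)| ≤ γ.lineIntegral g

theorem hasUnitSpeedOn_of_dist_eq {f : ℝ → X} {s : Set ℝ}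
    (h : ∀ a ∈ s, ∀ b ∈ s, dist (f a) (f b) = |a - b|) : HasUnitSpeedOn f s := by
  rw [HasUnitSpeedOn, hasConstantSpeedOnWith_iff_ordered]
  intro a ha b hb _
  have hvar : eVariationOn f (s ∩ Icc a b) = eVariationOn (id : ℝ → ℝ) (s ∩ Icc a b) := by
    refine iSup_congr fun p => Finset.sum_congr rfl fun i _ => ?_
    simp only [edist_dist, h _ (p.2.2.2 _).1 _ (p.2.2.2 _).1, id_eq, Real.dist_eq]
  rw [hvar, NNReal.coe_one, one_mul]
  exact (monotone_id.monotoneOn s).eVariationOn_eq ha hb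

theorem lintegral_Icc_zero_eq_mul {L : ℝ} (hL : 0 < L) (f : ℝ → ℝ≥0∞) :
    ∫⁻ s in Icc 0 L, f s = ENNReal.ofReal L * ∫⁻ t in Icc (0 : ℝ) 1, f (L * t) := by
  have himage : (fun t : ℝ => L * t) '' Icc (0 : ℝ) 1 = Icc 0 L := by
    rw [image_mul_left_Icc hL.le zero_le_one, mul_zero, mul_one]
  rw [← himage, lintegral_image_eq_lintegral_abs_deriv_mul (f' := fun _ => L) measurableSet_Icc
    (fun t _ => by simpa using ((hasDerivAt_id t).const_mul L).hasDerivWithinAt)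
    (mul_right_injective₀ hL.ne').injOn, abs_of_pos hL,
    lintegral_const_mul' _ _ ENNReal.ofReal_ne_top]

theorem lintegral_Icc_zero_one_le_add (f : ℝ → ℝ≥0∞) :
    ∫⁻ t in Icc (0 : ℝ) 1, f t ≤
      (∫⁻ t in Icc (1 / 2 : ℝ) 1, f t) + ∫⁻ t in Icc (1 / 2 : ℝ) 1, f (1 - t) := by
  have hreflect : ∫⁻ t in Icc (1 / 2 : ℝ) 1, f (1 - t) = ∫⁻ t in Icc (0 : ℝ) (1 / 2), f t := by
    have hpreimage : (fun t : ℝ => 1 - t) ⁻¹' Icc 0 (1 / 2) = Icc (1 / 2) 1 := by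
      rw [preimage_const_sub_Icc]
      norm_num
    rw [← hpreimage]
    exact (Measure.measurePreserving_sub_left volume (1 : ℝ)).setLIntegral_comp_preimage_emb
      (MeasurableEquiv.subLeft (1 : ℝ)).measurableEmbedding f _
  rw [hreflect, add_comm, ← Icc_union_Icc_eq_Icc (b := (1 / 2 : ℝ)) (by norm_num) (by norm_num)]
  exact lintegral_union_le _ _ _

theorem IsUpperGradient.ofReal_abs_sub_le_lintegral_point (hg : IsUpperGradient u g)
    (γ : Geod X) :
    ENNReal.ofReal |u (ev 0 γ) - u (ev 1 γ)| ≤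
      ENNReal.ofReal (dist (ev 0 γ) (ev 1 γ)) * ∫⁻ t in Icc (0 : ℝ) 1, g (γ.point t) := by
  rcases (dist_nonneg (x := ev 0 γ) (y := ev 1 γ)).eq_or_lt with hzero | hpos
  · rw [dist_eq_zero.1 hzero.symm]
    simp
  set L := dist (ev 0 γ) (ev 1 γ) with hL
  have hmem : ∀ a ∈ Icc 0 L, a / L ∈ Icc (0 : ℝ) 1 := fun a ha =>
    ⟨div_nonneg ha.1 hpos.le, (div_le_one hpos).2 ha.2⟩
  have hspeed : HasUnitSpeedOn (fun s => γ.point (s / L)) (Icc 0 L) :=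
    hasUnitSpeedOn_of_dist_eq fun a ha b hb => by
      rw [γ.dist_point (hmem a ha) (hmem b hb), ← hL, ← sub_div, abs_div, abs_of_pos hpos,
        div_mul_cancel₀ _ hpos.ne']
  have hcurve := hg ⟨L, hpos, fun s => γ.point (s / L), hspeed⟩
  simp only [RectCurve.lineIntegral, zero_div, div_self hpos.ne', γ.point_zero, γ.point_one]
    at hcurve
  simpa only [lintegral_Icc_zero_eq_mul hpos, mul_div_cancel_left₀ _ hpos.ne'] using hcurve

theorem tsum_lintegral_le_lintegral_tsum {α ι : Type*} [MeasurableSpace α] (ν : Measure α)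
    (f : ι → α → ℝ≥0∞) : ∑' i, ∫⁻ a, f i a ∂ν ≤ ∫⁻ a, ∑' i, f i a ∂ν := by
  classical
  have hfinite (s : Finset ι) : ∑ i ∈ s, ∫⁻ a, f i a ∂ν ≤ ∫⁻ a, ∑ i ∈ s, f i a ∂ν := by
    induction s using Finset.induction_on with
    | empty => simp
    | insert i s hi ih =>
      simp only [Finset.sum_insert hi]
      exact (add_le_add_right ih _).trans (le_lintegral_add _ _)
  rw [ENNReal.tsum_eq_iSup_sum]
  exact iSup_le fun s => (hfinite s).trans (lintegral_mono fun a => ENNReal.sum_le_tsum s)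

variable [MeasurableSpace X] {μ : Measure X}

theorem exists_lineIntegral_eq_top_of_modulusOne_eq_zero {F : Set (RectCurve X)}
    (hF : modulusOne μ F = 0) :
    ∃ ρ : X → ℝ≥0∞, Measurable ρ ∧ ∫⁻ x, ρ x ∂μ ≠ ∞ ∧ ∀ γ ∈ F, γ.lineIntegral ρ = ∞ := by
  obtain ⟨ε, hε, hsum⟩ := ENNReal.exists_pos_sum_of_countable' (one_ne_zero (α := ℝ≥0∞)) ℕ
  have hadmissible : ∀ k, ∃ ρ : X → ℝ≥0∞, Measurable ρ ∧ (∀ γ ∈ F, 1 ≤ γ.lineIntegral ρ) ∧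
      ∫⁻ x, ρ x ∂μ < ε k := fun k => by
    simpa only [modulusOne, iInf_lt_iff, exists_prop] using hF.trans_lt (hε k)
  choose ρ hρm hρF hρ using hadmissible
  refine ⟨fun x => ∑' k, ρ k x, Measurable.tsum hρm, ?_, fun γ hγ => top_unique ?_⟩
  · rw [lintegral_tsum fun k => (hρm k).aemeasurable]
    exact ((ENNReal.tsum_le_tsum fun k => (hρ k).le).trans_lt (hsum.trans_le le_top)).ne
  · calc ∞ = ∑' _ : ℕ, 1 := (ENNReal.tsum_const_eq_top_of_ne_zero one_ne_zero).symm
      _ ≤ ∑' k, γ.lineIntegral (ρ k) := ENNReal.tsum_le_tsum fun k => hρF k γ hγ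
      _ ≤ γ.lineIntegral fun x => ∑' k, ρ k x := tsum_lintegral_le_lintegral_tsum _ _

theorem IsWeakUpperGradient.exists_isUpperGradient_add (hg : IsWeakUpperGradient μ u g) :
    ∃ ρ : X → ℝ≥0∞, Measurable ρ ∧ ∫⁻ x, ρ x ∂μ ≠ ∞ ∧
      ∀ ε ≠ 0, IsUpperGradient u fun x => g x + ε * ρ x := by
  obtain ⟨ρ, hρm, hρ, htop⟩ := exists_lineIntegral_eq_top_of_modulusOne_eq_zero hg.2
  refine ⟨ρ, hρm, hρ, fun ε hε γ => ?_⟩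
  by_cases hγ : ENNReal.ofReal |u (γ.toFun 0) - u (γ.toFun γ.length)| ≤ γ.lineIntegral g
  · exact hγ.trans (lintegral_mono fun s => le_self_add)
  · calc ENNReal.ofReal |u (γ.toFun 0) - u (γ.toFun γ.length)| ≤ ∞ := le_top
      _ = ε * γ.lineIntegral ρ := by rw [htop γ hγ, ENNReal.mul_top hε]
      _ ≤ ∫⁻ s in Icc 0 γ.length, ε * ρ (γ.toFun s) := lintegral_const_mul_le _ _
      _ ≤ γ.lineIntegral fun x => g x + ε * ρ x := lintegral_mono fun s => le_add_self

end UpperGradients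

section Poincare

theorem lintegral_enorm_sub_average_le {Ω E : Type*} [MeasurableSpace Ω] [NormedAddCommGroup E]
    [NormedSpace ℝ E] [CompleteSpace E] {ν : Measure Ω} [IsFiniteMeasure ν] {u : Ω → E}
    (hu : Integrable u ν) :
    ∫⁻ y, ‖u y - ⨍ z, u z ∂ν‖ₑ ∂ν ≤ (ν univ)⁻¹ * ∫⁻ p, ‖u p.1 - u p.2‖ₑ ∂ν.prod ν := by
  rcases eq_zero_or_neZero ν with rfl | _
  · simp
  have hpointwise (c : E) : ‖c - ⨍ z, u z ∂ν‖ₑ ≤ (ν univ)⁻¹ * ∫⁻ z, ‖c - u z‖ₑ ∂ν :=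
    calc ‖c - ⨍ z, u z ∂ν‖ₑ = ‖∫ z, (c - u z) ∂((ν univ)⁻¹ • ν)‖ₑ := by
          rw [integral_sub (integrable_const c) hu.to_average, average, integral_const,
            probReal_univ, one_smul]
      _ ≤ ∫⁻ z, ‖c - u z‖ₑ ∂((ν univ)⁻¹ • ν) := enorm_integral_le_lintegral_enorm _
      _ = (ν univ)⁻¹ * ∫⁻ z, ‖c - u z‖ₑ ∂ν := by rw [lintegral_smul_measure, smul_eq_mul]
  have hmeas : AEMeasurable (fun p : Ω × Ω => ‖u p.1 - u p.2‖ₑ) (ν.prod ν) :=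
    (hu.1.comp_fst.sub hu.1.comp_snd).enorm
  rw [lintegral_prod _ hmeas, ← lintegral_const_mul' _ _ (by simp [NeZero.ne])]
  exact lintegral_mono fun y => hpointwise (u y)

variable {X : Type*} [MetricSpace X] {u : X → ℝ} {g : X → ℝ≥0∞}

/-- The line integral of `g` along the second half of the chosen geodesic from `p.1` to `p.2`. -/
noncomputable def IsGeodesicSpace.halfIntegral (h : IsGeodesicSpace X) (g : X → ℝ≥0∞)
    (p : X × X) : ℝ≥0∞ :=
  ENNReal.ofReal (dist p.1 p.2) * ∫⁻ t in Icc (1 / 2 : ℝ) 1, g (h.interp p.1 p.2 t)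

theorem IsUpperGradient.ofReal_abs_sub_le_halfIntegral_add (hg : IsUpperGradient u g)
    (h : IsGeodesicSpace X) (hbr : IsNonbranching X) {y z : X} (hzy : (z, y) ∈ extendable X) :
    ENNReal.ofReal |u y - u z| ≤ h.halfIntegral g (y, z) + h.halfIntegral g (z, y) := by
  have hreverse : ∀ t ∈ Icc (1 / 2 : ℝ) 1, h.interp y z (1 - t) = h.interp z y t := fun t ht => by
    have ht' : t ∈ Icc (0 : ℝ) 1 := Icc_subset_Icc_left (by norm_num) ht
    have hdiv := (h.dividesAt_interp y z (Icc.mem_iff_one_sub_mem.1 ht')).symm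
    rw [sub_sub_cancel] at hdiv
    exact hbr.eq_of_dividesAt hzy ht' hdiv (h.dividesAt_interp z y ht')
  calc ENNReal.ofReal |u y - u z|
      ≤ ENNReal.ofReal (dist y z) * ∫⁻ t in Icc (0 : ℝ) 1, g (h.interp y z t) := by
        simpa only [IsGeodesicSpace.interp, h.ev_zero_geod, h.ev_one_geod]
          using hg.ofReal_abs_sub_le_lintegral_point (h.geod y z)
    _ ≤ ENNReal.ofReal (dist y z) * ((∫⁻ t in Icc (1 / 2 : ℝ) 1, g (h.interp y z t)) +
          ∫⁻ t in Icc (1 / 2 : ℝ) 1, g (h.interp y z (1 - t))) := by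
        gcongr
        exact lintegral_Icc_zero_one_le_add _
    _ = h.halfIntegral g (y, z) + h.halfIntegral g (z, y) := by
        rw [mul_add, setLIntegral_congr_fun measurableSet_Icc fun t ht =>
          congrArg g (hreverse t ht), IsGeodesicSpace.halfIntegral, IsGeodesicSpace.halfIntegral,
          dist_comm z y]

variable [MeasurableSpace X] {μ : Measure X} {n : ℝ}

theorem HasContractionBound.setLIntegral_comp_le (hμ : HasContractionBound μ n) {x : X} {t : ℝ}
    (ht : t ∈ Ioc (0 : ℝ) 1) {Φ : X → X} (hΦ : ∀ y, DividesAt t x (Φ y) y) {A C : Set X}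
    (hmaps : MapsTo Φ A C) (hm : AEMeasurable Φ (μ.restrict A)) (hg : Measurable g) :
    ∫⁻ y in A, g (Φ y) ∂μ ≤ ENNReal.ofReal (t⁻¹ ^ n) * ∫⁻ y in C, g y ∂μ := by
  have hmap : (μ.restrict A).map Φ ≤ ENNReal.ofReal (t⁻¹ ^ n) • μ.restrict C := by
    refine Measure.le_iff.2 fun B hB => ?_
    rw [Measure.map_apply_of_aemeasurable hm hB, Measure.restrict_apply₀ (hm.nullMeasurable hB),
      Measure.smul_apply, Measure.restrict_apply hB, smul_eq_mul]
    exact (measure_mono (subset_inter inter_subset_left (inter_subset_right.trans hmaps))).trans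
      (hμ x t ht Φ hΦ (B ∩ C))
  rw [← lintegral_map' hg.aemeasurable hm, ← smul_eq_mul, ← lintegral_smul_measure]
  exact lintegral_mono' hmap le_rfl

variable [BorelSpace X] [ProperSpace X]

theorem HasContractionBound.ae_prod_extendable (hμ : HasContractionBound μ n)
    (h : IsGeodesicSpace X) (hb : BallsPosFinite μ) {ν : Measure X} [SFinite ν] (hν : ν ≪ μ) :
    ∀ᵐ p ∂ν.prod ν, p ∈ extendable X :=
  (Measure.ae_prod_mem_iff_ae_ae_mem measurableSet_extendable).2 <|
    .of_forall fun y => hν.ae_le (hμ.ae_extendable h hb y)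

theorem IsGeodesicSpace.aemeasurable_comp_interp (h : IsGeodesicSpace X)
    (hbr : IsNonbranching X) {Ω : Type*} [MeasurableSpace Ω] {ν : Measure Ω} [SFinite ν]
    {c : Ω → X × X} (hc : Measurable c) (hν : ∀ᵐ ω ∂ν, c ω ∈ extendable X) (hg : Measurable g) :
    AEMeasurable (fun q : Ω × ℝ => g (h.interp (c q.1).1 (c q.1).2 q.2))
      (ν.prod (volume.restrict (Icc (1 / 2 : ℝ) 1))) := by
  refine hg.comp_aemeasurable
    (h.aemeasurable_interp hbr (c := fun q : Ω × ℝ => (c q.1, q.2)) (by fun_prop) ?_)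
  have htime : ∀ᵐ t ∂volume.restrict (Icc (1 / 2 : ℝ) 1), t ∈ Icc (0 : ℝ) 1 :=
    (ae_restrict_mem measurableSet_Icc).mono fun t => (Icc_subset_Icc_left (by norm_num) ·)
  filter_upwards [Measure.quasiMeasurePreserving_fst.ae hν,
    Measure.quasiMeasurePreserving_snd.ae htime] with q hq hqt using ⟨hq, hqt⟩

/-- On the second half of a geodesic issuing from `y` the contraction towards `y` has a factor of
at least `1 / 2`, so it increases integrals at most by the factor `2 ^ n`. -/
theorem HasContractionBound.setLIntegral_interp_le (hμ : HasContractionBound μ n)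
    (h : IsGeodesicSpace X) (hbr : IsNonbranching X) (hb : BallsPosFinite μ) (hg : Measurable g)
    {x y : X} {r t : ℝ} (hy : y ∈ ball x r) (ht : t ∈ Icc (1 / 2 : ℝ) 1) :
    ∫⁻ z in ball x r, g (h.interp y z t) ∂μ ≤ 2 ^ n * ∫⁻ z in ball x (3 * r), g z ∂μ := by
  have ht0 : 0 < t := one_half_pos.trans_le ht.1
  have ht' : t ∈ Icc (0 : ℝ) 1 := ⟨ht0.le, ht.2⟩
  have hmaps : MapsTo (fun z => h.interp y z t) (ball x r) (ball x (3 * r)) := fun z hz => by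
    rw [mem_ball]
    linarith [dist_triangle_left (h.interp y z t) x y, h.dist_interp_le y z ht',
      dist_triangle_right y z x, mem_ball.1 hy, mem_ball.1 hz]
  have hm : AEMeasurable (fun z => h.interp y z t) (μ.restrict (ball x r)) :=
    h.aemeasurable_interp hbr (c := fun z => ((y, z), t)) (by fun_prop)
      (ae_restrict_of_ae ((hμ.ae_extendable h hb y).mono fun z hz => ⟨hz, ht'⟩))
  have hfactor : ENNReal.ofReal (t⁻¹ ^ n) ≤ 2 ^ n := by
    rw [← ENNReal.ofReal_rpow_of_pos (inv_pos.2 ht0), ← ENNReal.ofReal_ofNat 2]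
    refine ENNReal.rpow_le_rpow (ENNReal.ofReal_le_ofReal ?_) (hμ.exponent_nonneg h hb x)
    rw [inv_le_comm₀ ht0 two_pos, ← one_div]
    exact ht.1
  calc ∫⁻ z in ball x r, g (h.interp y z t) ∂μ
      ≤ ENNReal.ofReal (t⁻¹ ^ n) * ∫⁻ z in ball x (3 * r), g z ∂μ :=
        hμ.setLIntegral_comp_le ⟨ht0, ht.2⟩ (fun z => h.dividesAt_interp y z ht') hmaps hm hg
    _ ≤ 2 ^ n * ∫⁻ z in ball x (3 * r), g z ∂μ := by gcongr

theorem HasContractionBound.setLIntegral_halfIntegral_le (hμ : HasContractionBound μ n)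
    (h : IsGeodesicSpace X) (hbr : IsNonbranching X) (hb : BallsPosFinite μ) (hg : Measurable g)
    {x y : X} {r : ℝ} (hy : y ∈ ball x r) :
    ∫⁻ z in ball x r, h.halfIntegral g (y, z) ∂μ ≤
      2 ^ n * ENNReal.ofReal r * ∫⁻ z in ball x (3 * r), g z ∂μ := by
  have hr : 0 < r := pos_of_mem_ball hy
  have hdist : ∀ z ∈ ball x r, dist y z ≤ 2 * r := fun z hz => by
    linarith [dist_triangle_right y z x, mem_ball.1 hy, mem_ball.1 hz]
  have : IsFiniteMeasure (μ.restrict (ball x r)) := ⟨by simpa using (hb x r hr).2⟩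
  have hext : ∀ᵐ z ∂μ.restrict (ball x r), (y, z) ∈ extendable X :=
    ae_restrict_of_ae (hμ.ae_extendable h hb y)
  calc ∫⁻ z in ball x r, h.halfIntegral g (y, z) ∂μ
      ≤ ∫⁻ z in ball x r, (ENNReal.ofReal (2 * r) *
          ∫⁻ t in Icc (1 / 2 : ℝ) 1, g (h.interp y z t)) ∂μ :=
        setLIntegral_mono' isOpen_ball.measurableSet fun z hz =>
          mul_le_mul_left (ENNReal.ofReal_le_ofReal (hdist z hz)) _
    _ = ENNReal.ofReal (2 * r) *
          ∫⁻ t in Icc (1 / 2 : ℝ) 1, ∫⁻ z in ball x r, g (h.interp y z t) ∂μ := by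
        rw [lintegral_const_mul' _ _ ENNReal.ofReal_ne_top, lintegral_lintegral_swap
          (h.aemeasurable_comp_interp hbr (c := fun z => (y, z)) (by fun_prop) hext hg)]
    _ ≤ ENNReal.ofReal (2 * r) *
          ∫⁻ _ in Icc (1 / 2 : ℝ) 1, 2 ^ n * ∫⁻ z in ball x (3 * r), g z ∂μ := by
        gcongr ENNReal.ofReal (2 * r) * ?_
        exact setLIntegral_mono' measurableSet_Icc fun t ht =>
          hμ.setLIntegral_interp_le h hbr hb hg hy ht
    _ = 2 ^ n * ENNReal.ofReal r * ∫⁻ z in ball x (3 * r), g z ∂μ := by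
        rw [setLIntegral_const, Real.volume_Icc, mul_comm (2 ^ n * _), ← mul_assoc,
          ← ENNReal.ofReal_mul (by positivity), show 2 * r * (1 - 1 / 2) = r by ring]
        ring

theorem HasContractionBound.lintegral_prod_halfIntegral_le (hμ : HasContractionBound μ n)
    (h : IsGeodesicSpace X) (hbr : IsNonbranching X) (hb : BallsPosFinite μ) (hg : Measurable g)
    (x : X) (r : ℝ) :
    ∫⁻ p, h.halfIntegral g p ∂(μ.restrict (ball x r)).prod (μ.restrict (ball x r)) ≤
      μ (ball x r) * (2 ^ n * ENNReal.ofReal r * ∫⁻ z in ball x (3 * r), g z ∂μ) :=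
  calc ∫⁻ p, h.halfIntegral g p ∂(μ.restrict (ball x r)).prod (μ.restrict (ball x r))
      ≤ ∫⁻ y in ball x r, ∫⁻ z in ball x r, h.halfIntegral g (y, z) ∂μ ∂μ :=
        lintegral_prod_le _
    _ ≤ ∫⁻ _ in ball x r, (2 ^ n * ENNReal.ofReal r * ∫⁻ z in ball x (3 * r), g z ∂μ) ∂μ :=
        setLIntegral_mono' isOpen_ball.measurableSet fun y hy =>
          hμ.setLIntegral_halfIntegral_le h hbr hb hg hy
    _ = μ (ball x r) * (2 ^ n * ENNReal.ofReal r * ∫⁻ z in ball x (3 * r), g z ∂μ) := by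
        rw [setLIntegral_const, mul_comm]

theorem HasContractionBound.poincare_of_isUpperGradient (hμ : HasContractionBound μ n)
    (h : IsGeodesicSpace X) (hbr : IsNonbranching X) (hb : BallsPosFinite μ)
    (hg : IsUpperGradient u g) (hgm : Measurable g) {x : X} {r : ℝ} (hr : 0 < r)
    (hu : IntegrableOn u (ball x r) μ) :
    ∫⁻ y in ball x r, ENNReal.ofReal |u y - ⨍ z in ball x r, u z ∂μ| ∂μ ≤
      2 ^ (n + 1) * ENNReal.ofReal r * ∫⁻ y in ball x (3 * r), g y ∂μ := by
  obtain ⟨hpos, hfin⟩ := hb x r hr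
  let ν : Measure X := μ.restrict (ball x r)
  have : IsFiniteMeasure ν := ⟨by simpa [ν] using hfin⟩
  let M : ℝ≥0∞ := 2 ^ n * ENNReal.ofReal r * ∫⁻ y in ball x (3 * r), g y ∂μ
  have hext : ∀ᵐ p ∂ν.prod ν, p ∈ extendable X :=
    hμ.ae_prod_extendable h hb Measure.restrict_le_self.absolutelyContinuous
  have hJ : AEMeasurable (h.halfIntegral g) (ν.prod ν) :=
    (by fun_prop : AEMeasurable (fun p : X × X => ENNReal.ofReal (dist p.1 p.2)) (ν.prod ν)).mul
      (h.aemeasurable_comp_interp hbr measurable_id hext hgm).lintegral_prod_right'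
  calc ∫⁻ y, ENNReal.ofReal |u y - ⨍ z, u z ∂ν| ∂ν
      ≤ (μ (ball x r))⁻¹ * ∫⁻ p, ENNReal.ofReal |u p.1 - u p.2| ∂ν.prod ν := by
        simpa only [Real.enorm_eq_ofReal_abs, ν, Measure.restrict_apply_univ]
          using lintegral_enorm_sub_average_le hu
    _ ≤ (μ (ball x r))⁻¹ *
          ∫⁻ p, h.halfIntegral g p + h.halfIntegral g p.swap ∂ν.prod ν := by
        gcongr 1
        refine lintegral_mono_ae ?_
        filter_upwards [Measure.measurePreserving_swap.quasiMeasurePreserving.ae hext] with p hp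
        exact hg.ofReal_abs_sub_le_halfIntegral_add h hbr hp
    _ = (μ (ball x r))⁻¹ * (2 * ∫⁻ p, h.halfIntegral g p ∂ν.prod ν) := by
        rw [lintegral_add_left' hJ, lintegral_prod_swap (h.halfIntegral g), two_mul]
    _ ≤ (μ (ball x r))⁻¹ * (2 * (μ (ball x r) * M)) := by
        gcongr
        exact hμ.lintegral_prod_halfIntegral_le h hbr hb hgm x r
    _ = 2 ^ (n + 1) * ENNReal.ofReal r * ∫⁻ y in ball x (3 * r), g y ∂μ := by
        rw [ENNReal.rpow_add _ _ two_ne_zero ENNReal.ofNat_ne_top, ENNReal.rpow_one,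
          mul_left_comm 2, ENNReal.inv_mul_cancel_left hpos.ne' hfin.ne]
        ring

theorem HasContractionBound.weakPoincareOneOne (hμ : HasContractionBound μ n)
    (h : IsGeodesicSpace X) (hbr : IsNonbranching X) (hb : BallsPosFinite μ) :
    WeakPoincareOneOne μ (2 ^ (n + 1)) 3 := by
  intro x r hr u g hu hg
  obtain ⟨ρ, hρm, hρ, hupper⟩ := hg.exists_isUpperGradient_add
  let C : ℝ≥0∞ := 2 ^ (n + 1) * ENNReal.ofReal r
  let G : ℝ≥0∞ := ∫⁻ y in ball x (3 * r), g y ∂μ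
  let R : ℝ≥0∞ := ∫⁻ y in ball x (3 * r), ρ y ∂μ
  have hn : 0 ≤ n := hμ.exponent_nonneg h hb x
  have hR : R ≠ ∞ := ne_top_of_le_ne_top hρ (setLIntegral_le_lintegral _ _)
  have hC : C ≠ ∞ := ENNReal.mul_ne_top
    (ENNReal.rpow_ne_top_of_nonneg (by linarith) ENNReal.ofNat_ne_top) ENNReal.ofReal_ne_top
  have hperturbed : ∀ ε ≠ 0, ∫⁻ y in ball x r,
      ENNReal.ofReal |u y - ⨍ z in ball x r, u z ∂μ| ∂μ ≤ C * (G + ε * R) := fun ε hε => by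
    have := hμ.poincare_of_isUpperGradient h hbr hb (hupper ε hε)
      (hg.1.add (hρm.const_mul ε)) hr hu
    rwa [lintegral_add_left hg.1, lintegral_const_mul _ hρm] at this
  have hlim : Tendsto (fun ε : ℝ≥0∞ => C * (G + ε * R)) (𝓝[>] 0) (𝓝 (C * (G + 0 * R))) :=
    ENNReal.Tendsto.const_mul (tendsto_const_nhds.add
      (ENNReal.Tendsto.mul_const nhdsWithin_le_nhds (.inr hR))) (.inr hC)
  rw [zero_mul, add_zero] at hlim
  refine ge_of_tendsto hlim ?_
  filter_upwards [self_mem_nhdsWithin] with ε hε using hperturbed ε (ne_of_gt hε)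

end Poincare

end BusemannConcave

open BusemannConcave in
theorem mainTheorem2_general {X : Type*} [MetricSpace X] [CompleteSpace X] [MeasurableSpace X]
    [BorelSpace X] (h : IsGeodesicSpace X) (hbr : IsNonbranching X) {μ : Measure X} {n : ℝ}
    (hμ : HasContractionBound μ n)
    (hnontriv : ∃ (x : X) (r : ℝ), 0 < r ∧ 0 < μ (Metric.ball x r) ∧ μ (Metric.ball x r) < ∞) :
    MCPZero μ n ∧ BishopGromovZero μ n ∧ IsDoublingWith μ (2 ^ n) ∧
      WeakPoincareOneOne μ (2 ^ (n + 1)) 3 := by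
  have hb : BallsPosFinite μ := hμ.ballsPosFinite h hnontriv
  have : ProperSpace X := hμ.properSpace h hb
  exact ⟨hμ.mcpZero h hbr hb, hμ.bishopGromovZero h hb, hμ.isDoublingWith h hb,
    hμ.weakPoincareOneOne h hbr hb⟩

open BusemannConcave in
theorem mainTheorem2 (X : Type*) [MetricSpace X] [CompleteSpace X]
    [MeasurableSpace X] [BorelSpace X] (hX : IsBusemannConcave X)
    (n : ℝ) (hn : 0 ≤ n)
    (hnontriv : ∃ (x : X) (r : ℝ), 0 < r ∧
      0 < hausdorff X n (Metric.ball x r) ∧ hausdorff X n (Metric.ball x r) < ⊤) :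
    MCPZero (hausdorff X n) n ∧
    BishopGromovZero (hausdorff X n) n ∧
    IsDoublingWith (hausdorff X n) ((2 : ENNReal) ^ n) ∧
    WeakPoincareOneOne (hausdorff X n) ((2 : ENNReal) ^ (n + 1)) 3 :=
  mainTheorem2_general hX.1 hX.isNonbranching (hX.hasContractionBound_hausdorff hn) hnontriv
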